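/- Let $q$ be a prime power, $n\ge 1$, and for $u=(u_1,u_2),\,v=(v_1,v_2)\in\mathbb F_q^{n}\times\mathbb F_q^{n}=\mathbb F_q^{2n}$ put $\langle u,v\rangle_s=\langle u_1,v_2\rangle-\langle v_1,u_2\rangle$, where $\langle x,y\rangle=\sum_i x_iy_i$. For a linear code $C\subseteq\mathbb F_q^{2n}$ let $C^{\perp_s}=\{u\in\mathbb F_q^{2n} : \langle u,v\rangle_s=0 \text{ for all } v\in C\}$, and for $c=(x,y)$ let $w_s(c)=|\{i : (x_i,y_i)\neq(0,0)\}|$. A quantum code with parameters $[[n,K,d]]$ over $\mathbb F_q$ is a subspace $Q$ of $(\mathbb C^q)^{\otimes n}$ of dimension $q^K$ with minimum distance exactly $d$: with $P$ the orthogonal projection onto $Q$, every operator $E$ that acts as the identity outside some set of fewer than $d$ tensor factors is detected, i.e. $PEP=\lambda_E P$ for some $\lambda_E\in\mathbb C$, while some operator acting as the identity outside a set of $d$ tensor factors is not detected. For $K=0$, where this condition would be empty, "detected" means, as usual, $PEP=\frac{\operatorname{tr}E}{q^n}P$. **Theorem.** Let $C\subseteq\mathbb F_q^{2n}$ be a linear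 code of dimension $k$ with $C^{\perp_s}\subseteq C$. Then $k\ge n$, and there exists a quantum code with parameters $[[n,k-n,d_s]]$ over $\mathbb F_q$, where $$d_s=\min\{w_s(c) : c\in C\setminus C^{\perp_s}\}\quad\text{if } k>n,$$ and, when $k=n$ (so that $C=C^{\perp_s}$ and the set above is empty), $d_s=\min\{w_s(c) : c\in C,\ c\ne 0\}$. -/

import Mathlib

/-- The symplectic inner product `⟨u₁, v₂⟩ - ⟨v₁, u₂⟩` of `u = (u₁, u₂)` and `v = (v₁, v₂)` in
`F ^ (2n) = F ^ n × F ^ n`. -/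
def sympInner {F : Type*} [Field F] {n : ℕ} (u v : (Fin n → F) × (Fin n → F)) : F :=
  u.1 ⬝ᵥ v.2 - v.1 ⬝ᵥ u.2

/-- The symplectic dual of a linear code of length `2n`. -/
def sympDual {F : Type*} [Field F] {n : ℕ} (C : Submodule F ((Fin n → F) × (Fin n → F))) :
    Submodule F ((Fin n → F) × (Fin n → F)) where
  carrier := {u | ∀ v ∈ C, sympInner u v = 0}
  zero_mem' := by
    intro v _
    simp [sympInner]
  add_mem' := by
    intro a b ha hb v hv
    have h1 := ha v hv
    have h2 := hb v hv
    simp only [sympInner] at h1 h2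
    simp only [sympInner, Prod.fst_add, Prod.snd_add, add_dotProduct, dotProduct_add]
    linear_combination h1 + h2
  smul_mem' := by
    intro c a ha v hv
    have h1 := ha v hv
    simp only [sympInner] at h1
    simp only [sympInner, Prod.smul_fst, Prod.smul_snd, smul_dotProduct, dotProduct_smul,
      smul_eq_mul]
    linear_combination c * h1

/-- The symplectic weight of `(x, y)`: the number of `i` with `(x i, y i) ≠ (0, 0)`. -/
def sympWeight {F : Type*} [Field F] [DecidableEq F] {n : ℕ} (c : (Fin n → F) × (Fin n → F)) : ℕ :=
  (Finset.univ.filter fun i => (c.1 i, c.2 i) ≠ (0, 0)).card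

/-- The state space `(ℂ ^ q) ^ ⊗ n` of `n` qudits of dimension `q = |F|`, with the orthonormal basis
`|x⟩ = |x₁⟩ ⊗ ⋯ ⊗ |xₙ⟩` indexed by the `x : F ^ n`. -/
abbrev QuditSpace (F : Type*) [Fintype F] (n : ℕ) : Type _ := EuclideanSpace ℂ (Fin n → F)

/-- The operator `A ⊗ 1` on `n` qudits that acts by the arbitrary operator `A` on the qudits in `S`
and by the identity on the other ones. -/
def localOp {F : Type*} [DecidableEq F] {n : ℕ} (S : Finset (Fin n))
    (A : Matrix (S → F) (S → F) ℂ) : Matrix (Fin n → F) (Fin n → F) ℂ :=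
  fun x y => if ∀ i, i ∉ S → x i = y i then A (fun i => x i) (fun i => y i) else 0

/-- The code `Q` detects the error `E`: `P E P = c P` for some scalar `c`, where `P` is the orthogonal
projection onto `Q`, written through the matrix elements between code states. -/
def Detects {F : Type*} [Fintype F] [DecidableEq F] {n : ℕ} (Q : Submodule ℂ (QuditSpace F n))
    (E : Matrix (Fin n → F) (Fin n → F) ℂ) : Prop :=
  ∃ c : ℂ, ∀ φ ∈ Q, ∀ ψ ∈ Q, inner ℂ φ (Matrix.toEuclideanLin E ψ) = c * inner ℂ φ ψ

/-- The code `Q` detects the error `E` purely: the scalar `c` is the normalized trace of `E`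
(so it is zero for a traceless error). -/
def PurelyDetects {F : Type*} [Fintype F] [DecidableEq F] {n : ℕ}
    (Q : Submodule ℂ (QuditSpace F n)) (E : Matrix (Fin n → F) (Fin n → F) ℂ) : Prop :=
  ∀ φ ∈ Q, ∀ ψ ∈ Q, inner ℂ φ (Matrix.toEuclideanLin E ψ) =
    (E.trace / (Fintype.card F : ℂ) ^ n) * inner ℂ φ ψ

/-- `Q` is a quantum code with parameters `[[n, K, d]]` over `F`, `q = |F|`: a subspace of
dimension `q ^ K` of the space of `n` qudits, whose minimum distance is exactly `d`, that is, all errors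
on fewer than `d` qudits are detected, and some error on `d` qudits is not.
A one-dimensional code (`K = 0`) detects every error in the plain sense, so there, by the usual
convention, detection is pure detection. -/
structure IsQuantumCode {F : Type*} [Fintype F] [DecidableEq F] {n : ℕ}
    (Q : Submodule ℂ (QuditSpace F n)) (K d : ℕ) : Prop where
  finrank_eq : Module.finrank ℂ Q = Fintype.card F ^ K
  detects : ∀ S : Finset (Fin n), S.card < d → ∀ A : Matrix (S → F) (S → F) ℂ,
    if K = 0 then PurelyDetects Q (localOp S A) else Detects Q (localOp S A)
  not_detects : ∃ S : Finset (Fin n), S.card = d ∧ ∃ A : Matrix (S → F) (S → F) ℂ,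
    ¬ (if K = 0 then PurelyDetects Q (localOp S A) else Detects Q (localOp S A))

/-!
The Weyl operators `W(u)`, `u ∈ F ^ (2n)`, are unitary, multiply up to phases, and commute up to the
value of a primitive additive character `χ` at the symplectic product of their labels. Hence those
of the self-orthogonal code `D = C^⊥ₛ` commute, and since `ℂ` is algebraically closed they have a
joint eigenspace `Q ≠ 0`. The projection onto `Q` is a combination of the `W(u)`, `u ∈ D`, of which
only `W(0) = 1` has nonzero trace; so `dim Q = q ^ n / |D| = q ^ (k - n)`.

If `c ∈ D`, then `W(c)` is a scalar on `Q`. If `c ∉ C`, then some `u ∈ D` has `χ(⟨c, u⟩ₛ) ≠ 1`, and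
comparing eigenvalues of `W(u)` shows that `W(c)` maps `Q` into its orthogonal complement. If
`c ∈ C` but `c ∉ D = C^⊥ₛ`, then `W(c)` preserves `Q` and fails to commute with some `W(v)` that
also preserves `Q`, so it is not a scalar on `Q`. Thus `W(c)` is undetected exactly when
`c ∈ C ∖ D`. Detection in the pure sense also fails for `0 ≠ c ∈ D`, where `W(c)` has trace zero but
acts on `Q` as a nonzero scalar.

The operators acting on a set `S` of qudits are spanned by the `W(c)` with `c` supported in `S`, and
detected errors form a linear space, so the minimum distance is read off from the Weyl operators.
-/

theorem exists_iInf_eigenspace_ne_bot_of_commute {ι K V : Type*} [Field K] [IsAlgClosed K]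
    [AddCommGroup V] [Module K V] [FiniteDimensional K V] [Nontrivial V] (f : ι → Module.End K V)
    (hf : ∀ i j, Commute (f i) (f j)) :
    ∃ μ : ι → K, ⨅ i, (f i).eigenspace (μ i) ≠ ⊥ := by
  induction hdim : Module.finrank K V using Nat.strong_induction_on generalizing V with
  | _ m ih =>
  by_cases hscalar : ∀ i, ∃ c : K, (f i).eigenspace c = ⊤
  · choose μ hμ using hscalar
    exact ⟨μ, by simp [hμ]⟩
  · push Not at hscalar
    obtain ⟨i, hi⟩ := hscalar
    obtain ⟨c, hc⟩ := Module.End.exists_eigenvalue (f i)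
    let E := (f i).eigenspace c
    have hlt : Module.finrank K E < m := hdim ▸ Submodule.finrank_lt (hi c)
    have hmaps (j : ι) : Set.MapsTo (f j) E E :=
      Module.End.mapsTo_genEigenspace_of_comm (hf i j) c 1
    have : Nontrivial E := Submodule.nontrivial_iff_ne_bot.mpr hc
    obtain ⟨μ, hμ⟩ := ih _ hlt (fun j => (f j).restrict (hmaps j))
      (fun j k => LinearMap.restrict_commute (hf j k) (hmaps j) (hmaps k)) rfl
    obtain ⟨v, hv, hv0⟩ := Submodule.exists_mem_ne_zero_of_ne_bot hμ
    refine ⟨μ, (Submodule.ne_bot_iff _).mpr ⟨v, ?_, by simpa using hv0⟩⟩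
    simp only [Submodule.mem_iInf, Module.End.mem_eigenspace_iff] at hv ⊢
    exact fun j => congrArg Subtype.val (hv j)

section SymplecticForm

variable {F : Type*} [Field F] {n : ℕ}

lemma sympInner_swap (u v : (Fin n → F) × (Fin n → F)) : sympInner u v = -sympInner v u := by
  simp [sympInner]

lemma sympInner_smul_right (a : F) (u v : (Fin n → F) × (Fin n → F)) :
    sympInner u (a • v) = a * sympInner u v := by
  simp [sympInner, mul_sub]

variable (F n) in
/-- The symplectic inner product as a bilinear form, which gives access to the theory of orthogonal
complements. -/
def sympForm : LinearMap.BilinForm F ((Fin n → F) × (Fin n → F)) :=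
  let B := (dotProductBilin F F).compl₁₂ (.fst F (Fin n → F) (Fin n → F)) (.snd F _ _)
  B - B.flip

lemma sympForm_apply (u v : (Fin n → F) × (Fin n → F)) : sympForm F n u v = sympInner u v := rfl

lemma isRefl_sympForm : (sympForm F n).IsRefl := by
  intro u v h
  rw [sympForm_apply] at h ⊢
  rw [sympInner_swap, h, neg_zero]

lemma nondegenerate_sympForm : (sympForm F n).Nondegenerate := by
  refine (LinearMap.IsRefl.nondegenerate_iff_separatingLeft (B := sympForm F n)
    isRefl_sympForm).mpr fun u hu => ?_
  refine Prod.ext (dotProduct_eq_zero _ fun w => ?_) (dotProduct_eq_zero _ fun w => ?_)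
  · simpa [sympForm_apply, sympInner] using hu (0, w)
  · simpa [sympForm_apply, sympInner, dotProduct_comm] using hu (w, 0)

lemma sympDual_eq_orthogonal (C : Submodule F ((Fin n → F) × (Fin n → F))) :
    sympDual C = (sympForm F n).orthogonal C := by
  ext u
  exact forall₂_congr fun v _ => isRefl_sympForm.eq_iff

lemma sympDual_sympDual (C : Submodule F ((Fin n → F) × (Fin n → F))) :
    sympDual (sympDual C) = C := by
  rw [sympDual_eq_orthogonal, sympDual_eq_orthogonal,
    LinearMap.BilinForm.orthogonal_orthogonal nondegenerate_sympForm isRefl_sympForm]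

lemma finrank_add_finrank_sympDual (C : Submodule F ((Fin n → F) × (Fin n → F))) :
    Module.finrank F C + Module.finrank F (sympDual C) = 2 * n := by
  have hdual := LinearMap.BilinForm.finrank_orthogonal (nondegenerate_sympForm (F := F) (n := n)) C
  have hle := Submodule.finrank_le C
  have hambient : Module.finrank F ((Fin n → F) × (Fin n → F)) = 2 * n := by
    simp [Module.finrank_prod, two_mul]
  rw [sympDual_eq_orthogonal]
  omega

lemma exists_addChar_sympInner_ne_one {M : Type*} [CommMonoid M] {χ : AddChar F M}
    (hχ : χ.IsPrimitive) {D : Submodule F ((Fin n → F) × (Fin n → F))}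
    {c : (Fin n → F) × (Fin n → F)} (hc : c ∉ sympDual D) : ∃ v ∈ D, χ (sympInner c v) ≠ 1 := by
  obtain ⟨v, hv, hcv⟩ : ∃ v ∈ D, sympInner c v ≠ 0 := by
    by_contra! h
    exact hc h
  obtain ⟨a, ha⟩ := AddChar.ne_one_iff.mp (hχ hcv)
  refine ⟨a • v, D.smul_mem a hv, ?_⟩
  rwa [sympInner_smul_right, mul_comm]

end SymplecticForm

section WeylMatrix

variable {R ι : Type*} [CommRing R] [Fintype ι]

lemma sum_addChar_dotProduct [Fintype R] [DecidableEq R] [DecidableEq ι] {S : Type*} [CommRing S]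
    [IsDomain S]
    {χ : AddChar R S} (hχ : χ.IsPrimitive) (x : ι → R) :
    ∑ b : ι → R, χ (b ⬝ᵥ x) = if x = 0 then (Fintype.card (ι → R) : S) else 0 := by
  let ψ : AddChar (ι → R) S := χ.compAddMonoidHom ((dotProductBilin R R).flip x).toAddMonoidHom
  have hψ : ψ = 0 ↔ x = 0 := by
    refine ⟨fun h => funext fun i => ?_, fun h => by ext; simp [ψ, h, dotProductBilin]⟩
    by_contra hi
    refine hχ hi (DFunLike.ext _ _ fun a => ?_)
    simpa [ψ, dotProductBilin, mul_comm] using DFunLike.congr_fun h (Pi.single i a)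
  simp only [← hψ]
  exact ψ.sum_eq_ite

variable [DecidableEq R] (χ : AddChar R ℂ)

/-- The Weyl operator `|y⟩ ↦ χ(⟨u₂, y⟩) |y + u₁⟩` of `u = (u₁, u₂)`: the product of a shift by `u₁`
and a multiplication by the character `χ(⟨u₂, ·⟩)`. -/
def weylMatrix (u : (ι → R) × (ι → R)) : Matrix (ι → R) (ι → R) ℂ :=
  .of fun x y => if x = y + u.1 then χ (u.2 ⬝ᵥ y) else 0

lemma weylMatrix_apply (u : (ι → R) × (ι → R)) (x y : ι → R) :
    weylMatrix χ u x y = if x = y + u.1 then χ (u.2 ⬝ᵥ y) else 0 := rfl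

lemma weylMatrix_zero : weylMatrix χ (0 : (ι → R) × (ι → R)) = 1 := by
  ext x y
  simp [weylMatrix_apply, Matrix.one_apply]

variable [Fintype R] [DecidableEq ι]

lemma weylMatrix_mul (u v : (ι → R) × (ι → R)) :
    weylMatrix χ u * weylMatrix χ v = χ (u.2 ⬝ᵥ v.1) • weylMatrix χ (u + v) := by
  ext x y
  rw [Matrix.mul_apply, Fintype.sum_eq_single (y + v.1) fun z hz => by simp [weylMatrix_apply, hz]]
  simp only [weylMatrix_apply, Matrix.smul_apply, if_true, Prod.fst_add, Prod.snd_add, smul_eq_mul,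
    dotProduct_add, add_dotProduct, AddChar.map_add_eq_mul, add_assoc, add_comm v.1, ite_mul,
    mul_ite, mul_zero, zero_mul]
  congr 1
  ring

lemma weylMatrix_mem_unitaryGroup (u : (ι → R) × (ι → R)) :
    weylMatrix χ u ∈ Matrix.unitaryGroup (ι → R) ℂ := by
  rw [Matrix.mem_unitaryGroup_iff']
  ext x y
  rw [Matrix.mul_apply, Fintype.sum_eq_single (x + u.1) fun z hz => by
    simp [Matrix.star_apply, weylMatrix_apply, hz]]
  rcases eq_or_ne x y with rfl | hxy
  · simp [Matrix.star_apply, weylMatrix_apply, ← AddChar.map_neg_eq_conj, ← AddChar.map_add_eq_mul]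
  · simp [weylMatrix_apply, hxy]

variable {χ}

lemma trace_weylMatrix (hχ : χ.IsPrimitive) (u : (ι → R) × (ι → R)) :
    (weylMatrix χ u).trace = if u = 0 then (Fintype.card (ι → R) : ℂ) else 0 := by
  have hdiag : (weylMatrix χ u).trace = if u.1 = 0 then ∑ y, χ (y ⬝ᵥ u.2) else 0 := by
    simp [Matrix.trace, weylMatrix_apply, Finset.sum_ite_irrel, dotProduct_comm u.2]
  rw [hdiag, sum_addChar_dotProduct hχ, ← ite_and]
  simp only [Prod.ext_iff, Prod.fst_zero, Prod.snd_zero]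

lemma sum_smul_weylMatrix_eq_single (hχ : χ.IsPrimitive) (x y : ι → R) :
    ∑ b, χ (-(b ⬝ᵥ y)) • weylMatrix χ (x - y, b) =
      (Fintype.card (ι → R) : ℂ) • Matrix.single x y 1 := by
  ext x' y'
  have hshift : x' = y' + (x - y) ∧ y' - y = 0 ↔ x = x' ∧ y = y' := by
    constructor
    · rintro ⟨hx, hy⟩
      obtain rfl := sub_eq_zero.mp hy
      simp [hx]
    · rintro ⟨rfl, rfl⟩
      simp
  calc (∑ b, χ (-(b ⬝ᵥ y)) • weylMatrix χ (x - y, b)) x' y'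
      = if x' = y' + (x - y) then ∑ b, χ (b ⬝ᵥ (y' - y)) else 0 := by
        simp only [Matrix.sum_apply, Matrix.smul_apply, weylMatrix_apply, smul_eq_mul, mul_ite,
          mul_zero, Finset.sum_ite_irrel, Finset.sum_const_zero, ← AddChar.map_add_eq_mul,
          dotProduct_sub, neg_add_eq_sub]
    _ = ((Fintype.card (ι → R) : ℂ) • Matrix.single x y 1) x' y' := by
        rw [sum_addChar_dotProduct hχ, ← ite_and]
        simp [Matrix.single_apply, hshift]

end WeylMatrix

lemma span_range_weylMatrix {R ι : Type*} [CommRing R] [Finite R] [DecidableEq R] [Fintype ι]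
    {χ : AddChar R ℂ} (hχ : χ.IsPrimitive) :
    Submodule.span ℂ (Set.range (weylMatrix χ : (ι → R) × (ι → R) → _)) = ⊤ := by
  classical
  have := Fintype.ofFinite R
  refine eq_top_iff.mpr fun A _ => ?_
  rw [Matrix.matrix_eq_sum_single A]
  refine Submodule.sum_mem _ fun x _ => Submodule.sum_mem _ fun y _ => ?_
  have hcard : (Fintype.card (ι → R) : ℂ) ≠ 0 := Nat.cast_ne_zero.mpr Fintype.card_ne_zero
  have hsingle : Matrix.single x y (A x y) = (A x y * (Fintype.card (ι → R) : ℂ)⁻¹) •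
      ∑ b, χ (-(b ⬝ᵥ y)) • weylMatrix χ (x - y, b) := by
    rw [sum_smul_weylMatrix_eq_single hχ, smul_smul, inv_mul_cancel_right₀ hcard,
      Matrix.smul_single, smul_eq_mul, mul_one]
  rw [hsingle]
  exact Submodule.smul_mem _ _ <| Submodule.sum_mem _ fun b _ =>
    Submodule.smul_mem _ _ <| Submodule.subset_span ⟨_, rfl⟩

section LocalOperators

variable {F : Type*} [Field F] [DecidableEq F] {n : ℕ}

/-- The set of positions `i` with `(x i, y i) ≠ (0, 0)`, whose size is the symplectic weight of
`(x, y)`. -/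
def sympSupport (c : (Fin n → F) × (Fin n → F)) : Finset (Fin n) :=
  {i | (c.1 i, c.2 i) ≠ (0, 0)}

lemma card_sympSupport (c : (Fin n → F) × (Fin n → F)) : (sympSupport c).card = sympWeight c := rfl

lemma sympSupport_subset_iff {c : (Fin n → F) × (Fin n → F)} {S : Finset (Fin n)} :
    sympSupport c ⊆ S ↔ ∀ i ∉ S, c.1 i = 0 ∧ c.2 i = 0 := by
  simp only [sympSupport, Finset.subset_iff, Finset.mem_filter_univ, ne_eq, Prod.mk.injEq]
  exact forall_congr' fun i => not_imp_comm

lemma localOp_weylMatrix_restrict (χ : AddChar F ℂ) {S : Finset (Fin n)}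
    {c : (Fin n → F) × (Fin n → F)} (hc : sympSupport c ⊆ S) :
    localOp S (weylMatrix χ (S.restrict c.1, S.restrict c.2)) = weylMatrix χ c := by
  rw [sympSupport_subset_iff] at hc
  ext x y
  have hdot : S.restrict c.2 ⬝ᵥ (fun i : S => y i) = c.2 ⬝ᵥ y := by
    simp only [dotProduct, Finset.restrict]
    rw [Finset.sum_coe_sort S fun i => c.2 i * y i]
    refine Finset.sum_subset (Finset.subset_univ S) fun i _ hi => ?_
    rw [(hc i hi).2, zero_mul]
  have hshift : (∀ i ∉ S, x i = y i) ∧ (fun i : S => x i) = (fun i : S => y i) + S.restrict c.1 ↔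
      x = y + c.1 := by
    simp only [funext_iff, Pi.add_apply, Finset.restrict, Subtype.forall]
    refine ⟨fun ⟨hout, hin⟩ i => ?_, fun h => ⟨fun i hi => ?_, fun i _ => h i⟩⟩
    · by_cases hi : i ∈ S
      · exact hin i hi
      · rw [hout i hi, (hc i hi).1, add_zero]
    · rw [h i, (hc i hi).1, add_zero]
  simp only [localOp, weylMatrix_apply, hdot, ← ite_and, hshift]

lemma exists_localOp_weylMatrix_eq (χ : AddChar F ℂ) {S : Finset (Fin n)}
    (u : (S → F) × (S → F)) :
    ∃ c, sympSupport c ⊆ S ∧ localOp S (weylMatrix χ u) = weylMatrix χ c := by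
  let extendZero (w : S → F) : Fin n → F := Function.extend Subtype.val w 0
  have hrestrict (w : S → F) : S.restrict (extendZero w) = w :=
    funext (Subtype.val_injective.extend_apply w 0)
  have hzero (w : S → F) {i : Fin n} (hi : i ∉ S) : extendZero w i = 0 :=
    Function.extend_apply' _ _ _ (by simpa using hi)
  have hsupp : sympSupport (extendZero u.1, extendZero u.2) ⊆ S :=
    sympSupport_subset_iff.mpr fun i hi => ⟨hzero u.1 hi, hzero u.2 hi⟩
  refine ⟨(extendZero u.1, extendZero u.2), hsupp, ?_⟩
  rw [← localOp_weylMatrix_restrict χ hsupp, hrestrict, hrestrict]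

/-- `localOp` as a linear map in the local operator. -/
def localOpLinearMap (S : Finset (Fin n)) :
    Matrix (S → F) (S → F) ℂ →ₗ[ℂ] Matrix (Fin n → F) (Fin n → F) ℂ where
  toFun := localOp S
  map_add' A B := by
    ext x y
    simp only [localOp, Matrix.add_apply]
    split_ifs <;> simp
  map_smul' a A := by
    ext x y
    simp only [localOp, Matrix.smul_apply, RingHom.id_apply]
    split_ifs <;> simp

variable {χ : AddChar F ℂ} {p : Submodule ℂ (Matrix (Fin n → F) (Fin n → F) ℂ)}

lemma exists_localOp_notMem {d : ℕ} (hd : d ∈ sympWeight '' {c | weylMatrix χ c ∉ p}) :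
    ∃ S : Finset (Fin n), S.card = d ∧ ∃ A : Matrix (S → F) (S → F) ℂ, localOp S A ∉ p := by
  obtain ⟨c, hcp, rfl⟩ := hd
  refine ⟨sympSupport c, card_sympSupport c,
    weylMatrix χ ((sympSupport c).restrict c.1, (sympSupport c).restrict c.2), ?_⟩
  rwa [localOp_weylMatrix_restrict χ subset_rfl]

variable [Finite F]

lemma localOp_mem_of_forall_weylMatrix_mem (hχ : χ.IsPrimitive) {S : Finset (Fin n)}
    (hp : ∀ c, sympSupport c ⊆ S → weylMatrix χ c ∈ p) (A : Matrix (S → F) (S → F) ℂ) :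
    localOp S A ∈ p := by
  suffices h : ⊤ ≤ p.comap (localOpLinearMap S) from h (Submodule.mem_top (x := A))
  rw [← span_range_weylMatrix hχ, Submodule.span_le]
  rintro _ ⟨u, rfl⟩
  obtain ⟨c, hc, hu⟩ := exists_localOp_weylMatrix_eq χ u
  change localOp S (weylMatrix χ u) ∈ p
  exact hu ▸ hp c hc

lemma localOp_mem_of_card_lt (hχ : χ.IsPrimitive) {d : ℕ}
    (hd : d ∈ lowerBounds (sympWeight '' {c | weylMatrix χ c ∉ p})) {S : Finset (Fin n)}
    (hS : S.card < d) (A : Matrix (S → F) (S → F) ℂ) : localOp S A ∈ p := by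
  refine localOp_mem_of_forall_weylMatrix_mem hχ (fun c hc => ?_) A
  by_contra hcp
  exact hS.not_ge ((hd ⟨c, hcp, rfl⟩).trans (Finset.card_le_card hc))

end LocalOperators

section WeylOperator

variable {R ι : Type*} [CommRing R] [Fintype R] [DecidableEq R] [Fintype ι] [DecidableEq ι]
  (χ : AddChar R ℂ)

/-- The Weyl operator `weylMatrix χ u` as an endomorphism of the state space. -/
noncomputable def weylOp (u : (ι → R) × (ι → R)) : Module.End ℂ (EuclideanSpace ℂ (ι → R)) :=
  Matrix.toEuclideanLin (weylMatrix χ u)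

lemma weylOp_zero : weylOp χ (0 : (ι → R) × (ι → R)) = 1 := by
  rw [weylOp, weylMatrix_zero, Matrix.toLpLin_one, Module.End.one_eq_id]

lemma weylOp_mul (u v : (ι → R) × (ι → R)) :
    weylOp χ u * weylOp χ v = χ (u.2 ⬝ᵥ v.1) • weylOp χ (u + v) := by
  rw [weylOp, weylOp, weylOp, Module.End.mul_eq_comp, ← Matrix.toLpLin_mul_same, weylMatrix_mul,
    map_smul]

lemma weylOp_mul_comm (u v : (ι → R) × (ι → R)) :
    weylOp χ u * weylOp χ v = χ (v.1 ⬝ᵥ u.2 - u.1 ⬝ᵥ v.2) • (weylOp χ v * weylOp χ u) := by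
  rw [weylOp_mul, weylOp_mul, smul_smul, ← AddChar.map_add_eq_mul, add_comm v u,
    dotProduct_comm v.2, sub_add_cancel, dotProduct_comm v.1]

lemma inner_weylOp_weylOp (u : (ι → R) × (ι → R)) (φ ψ : EuclideanSpace ℂ (ι → R)) :
    inner ℂ (weylOp χ u φ) (weylOp χ u ψ) = inner ℂ φ ψ := by
  have hunitary : (weylMatrix χ u).conjTranspose * weylMatrix χ u = 1 :=
    Matrix.mem_unitaryGroup_iff'.mp (weylMatrix_mem_unitaryGroup χ u)
  rw [← LinearMap.adjoint_inner_right, weylOp, ← Matrix.toEuclideanLin_conjTranspose_eq_adjoint,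
    ← LinearMap.comp_apply, ← Matrix.toLpLin_mul_same, hunitary, Matrix.toLpLin_one,
    LinearMap.id_apply]

lemma norm_weylOp (u : (ι → R) × (ι → R)) (ψ : EuclideanSpace ℂ (ι → R)) :
    ‖weylOp χ u ψ‖ = ‖ψ‖ := by
  rw [@norm_eq_sqrt_re_inner ℂ, inner_weylOp_weylOp, ← @norm_eq_sqrt_re_inner ℂ]

lemma weylOp_ne_zero (u : (ι → R) × (ι → R)) {ψ : EuclideanSpace ℂ (ι → R)} (hψ : ψ ≠ 0) :
    weylOp χ u ψ ≠ 0 := by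
  rwa [← norm_ne_zero_iff, norm_weylOp, norm_ne_zero_iff]

variable {χ} in
lemma trace_weylOp (hχ : χ.IsPrimitive) (u : (ι → R) × (ι → R)) :
    LinearMap.trace ℂ _ (weylOp χ u) = if u = 0 then (Fintype.card (ι → R) : ℂ) else 0 := by
  rw [weylOp, Matrix.toEuclideanLin_eq_toLin_orthonormal, Matrix.trace_toLin_eq,
    trace_weylMatrix hχ]

end WeylOperator

section StabilizerCode

variable {R ι : Type*} [CommRing R] [Fintype R] [DecidableEq R] [Fintype ι] [DecidableEq ι]
  {A : Type*} [SetLike A ((ι → R) × (ι → R))]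

/-- The stabilizer code of `D`: the joint eigenspace of the Weyl operators of the `u ∈ D`, for the
eigenvalues `μ u`. Since these operators multiply only up to phases, not every `μ` occurs; the code
is zero for the other ones. -/
noncomputable def stabilizerCode (χ : AddChar R ℂ) (D : A) (μ : D → ℂ) :
    Submodule ℂ (EuclideanSpace ℂ (ι → R)) :=
  ⨅ u : D, (weylOp χ u.1).eigenspace (μ u)

namespace stabilizerCode

variable {χ : AddChar R ℂ} {D : A} {μ : D → ℂ}

lemma mem_iff {ψ : EuclideanSpace ℂ (ι → R)} :
    ψ ∈ stabilizerCode χ D μ ↔ ∀ u : D, weylOp χ u.1 ψ = μ u • ψ := by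
  simp only [stabilizerCode, Submodule.mem_iInf, Module.End.mem_eigenspace_iff]

lemma norm_eigenvalue (hQ : stabilizerCode χ D μ ≠ ⊥) (u : D) : ‖μ u‖ = 1 := by
  obtain ⟨ψ, hψ, hψ0⟩ := Submodule.exists_mem_ne_zero_of_ne_bot hQ
  refine mul_right_cancel₀ (norm_ne_zero_iff.mpr hψ0) ?_
  rw [← norm_smul, ← mem_iff.mp hψ u, norm_weylOp, one_mul]

lemma eigenvalue_ne_zero (hQ : stabilizerCode χ D μ ≠ ⊥) (u : D) : μ u ≠ 0 := by
  rw [← norm_ne_zero_iff, norm_eigenvalue hQ u]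
  exact one_ne_zero

variable [AddSubgroupClass A ((ι → R) × (ι → R))]

lemma eigenvalue_zero (hQ : stabilizerCode χ D μ ≠ ⊥) : μ 0 = 1 := by
  obtain ⟨ψ, hψ, hψ0⟩ := Submodule.exists_mem_ne_zero_of_ne_bot hQ
  refine smul_left_injective ℂ hψ0 ?_
  simpa [weylOp_zero] using (mem_iff.mp hψ 0).symm

lemma eigenvalue_mul (hQ : stabilizerCode χ D μ ≠ ⊥) (u v : D) :
    μ u * μ v = χ (u.1.2 ⬝ᵥ v.1.1) * μ (u + v) := by
  obtain ⟨ψ, hψ, hψ0⟩ := Submodule.exists_mem_ne_zero_of_ne_bot hQ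
  have heigen := mem_iff.mp hψ
  have h := LinearMap.congr_fun (weylOp_mul χ u.1 v.1) ψ
  rw [Module.End.mul_apply, LinearMap.smul_apply, ← AddMemClass.coe_add, heigen, heigen, map_smul,
    heigen, smul_smul, smul_smul, mul_comm] at h
  exact smul_left_injective ℂ hψ0 h

variable [Fintype D]

variable (χ D μ) in
/-- The average of the operators `(μ u)⁻¹ W(u)` over `u ∈ D`, which is the projection onto the
stabilizer code if the latter is nonzero. -/
noncomputable def proj : Module.End ℂ (EuclideanSpace ℂ (ι → R)) :=
  (Fintype.card D : ℂ)⁻¹ • ∑ u : D, (μ u)⁻¹ • weylOp χ u.1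

lemma weylOp_mul_proj (hQ : stabilizerCode χ D μ ≠ ⊥) (v : D) :
    weylOp χ v.1 * proj χ D μ = μ v • proj χ D μ := by
  have hterm (u : D) : weylOp χ v.1 * ((μ u)⁻¹ • weylOp χ u.1) =
      μ v • ((μ (v + u))⁻¹ • weylOp χ (v + u : D).1) := by
    rw [mul_smul_comm, weylOp_mul, smul_smul, smul_smul, AddMemClass.coe_add]
    congr 1
    have hmul := eigenvalue_mul hQ v u
    have hu := eigenvalue_ne_zero hQ u
    have hvu := eigenvalue_ne_zero hQ (v + u)
    field_simp
    rw [← hmul, mul_comm]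
  rw [proj, mul_smul_comm, Finset.mul_sum, smul_comm (μ v), Finset.smul_sum (r := μ v)]
  simp only [hterm]
  congr 1
  exact Equiv.sum_comp (Equiv.addLeft v) fun u : D => μ v • ((μ u)⁻¹ • weylOp χ u.1)

lemma proj_apply_of_mem (hQ : stabilizerCode χ D μ ≠ ⊥) {ψ : EuclideanSpace ℂ (ι → R)}
    (hψ : ψ ∈ stabilizerCode χ D μ) : proj χ D μ ψ = ψ := by
  have hterm (u : D) : (μ u)⁻¹ • weylOp χ u.1 ψ = ψ := by
    rw [mem_iff.mp hψ u, inv_smul_smul₀ (eigenvalue_ne_zero hQ u)]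
  simp only [proj, LinearMap.smul_apply, LinearMap.sum_apply, hterm, Finset.sum_const,
    Finset.card_univ]
  rw [← Nat.cast_smul_eq_nsmul ℂ, inv_smul_smul₀ (Nat.cast_ne_zero.mpr Fintype.card_ne_zero)]

lemma isProj_proj (hQ : stabilizerCode χ D μ ≠ ⊥) :
    LinearMap.IsProj (stabilizerCode χ D μ) (proj χ D μ) where
  map_mem ψ := mem_iff.mpr fun v => LinearMap.congr_fun (weylOp_mul_proj hQ v) ψ
  map_id _ hψ := proj_apply_of_mem hQ hψ

lemma trace_proj (hχ : χ.IsPrimitive) (hμ : μ 0 = 1) :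
    LinearMap.trace ℂ _ (proj χ D μ) = (Fintype.card D : ℂ)⁻¹ * Fintype.card (ι → R) := by
  rw [proj, map_smul, map_sum, Fintype.sum_eq_single 0 fun u hu => ?_]
  · simp [trace_weylOp hχ, hμ]
  · rw [map_smul, trace_weylOp hχ, if_neg (by simpa using hu), smul_zero]

lemma card_mul_finrank (hχ : χ.IsPrimitive) (hQ : stabilizerCode χ D μ ≠ ⊥) :
    Fintype.card D * Module.finrank ℂ (stabilizerCode χ D μ) = Fintype.card (ι → R) := by
  have htrace := (isProj_proj hQ).trace
  rw [trace_proj hχ (eigenvalue_zero hQ),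
    inv_mul_eq_iff_eq_mul₀ (Nat.cast_ne_zero.mpr Fintype.card_ne_zero)] at htrace
  exact_mod_cast htrace.symm

end stabilizerCode

end StabilizerCode

section SympDual

variable {F : Type*} [Field F] [Fintype F] [DecidableEq F] {n : ℕ} {χ : AddChar F ℂ}
  {D : Submodule F ((Fin n → F) × (Fin n → F))} {μ : D → ℂ}

lemma weylOp_weylOp_comm (χ : AddChar F ℂ) (u v : (Fin n → F) × (Fin n → F))
    (ψ : QuditSpace F n) :
    weylOp χ u (weylOp χ v ψ) = χ (sympInner v u) • weylOp χ v (weylOp χ u ψ) :=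
  LinearMap.congr_fun (weylOp_mul_comm χ u v) ψ

namespace stabilizerCode

lemma exists_ne_bot (χ : AddChar F ℂ) (hD : D ≤ sympDual D) :
    ∃ μ : D → ℂ, stabilizerCode χ D μ ≠ ⊥ := by
  refine exists_iInf_eigenspace_ne_bot_of_commute (fun u : D => weylOp χ u.1) fun u v => ?_
  refine LinearMap.ext fun ψ => ?_
  rw [Module.End.mul_apply, weylOp_weylOp_comm, hD v.2 u u.2, AddChar.map_zero_eq_one, one_smul,
    Module.End.mul_apply]

lemma finrank_eq (hχ : χ.IsPrimitive) (hQ : stabilizerCode χ D μ ≠ ⊥) {K : ℕ}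
    (hK : Module.finrank F D + K = n) :
    Module.finrank ℂ (stabilizerCode χ D μ) = Fintype.card F ^ K := by
  classical
  have hcard := card_mul_finrank hχ hQ
  have hpow : Fintype.card F ^ n = Fintype.card F ^ Module.finrank F D * Fintype.card F ^ K := by
    rw [← pow_add, hK]
  rw [Module.card_eq_pow_finrank (K := F), Fintype.card_fun, Fintype.card_fin, hpow] at hcard
  exact Nat.eq_of_mul_eq_mul_left (pow_pos Fintype.card_pos _) hcard

lemma weylOp_mem {c : (Fin n → F) × (Fin n → F)} (hc : c ∈ sympDual D) {ψ : QuditSpace F n}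
    (hψ : ψ ∈ stabilizerCode χ D μ) : weylOp χ c ψ ∈ stabilizerCode χ D μ := by
  refine mem_iff.mpr fun u => ?_
  rw [weylOp_weylOp_comm, hc u u.2, AddChar.map_zero_eq_one, one_smul, mem_iff.mp hψ, map_smul]

lemma inner_weylOp_eq_zero (hχ : χ.IsPrimitive) {c : (Fin n → F) × (Fin n → F)}
    (hc : c ∉ sympDual D) {φ ψ : QuditSpace F n} (hφ : φ ∈ stabilizerCode χ D μ)
    (hψ : ψ ∈ stabilizerCode χ D μ) : inner ℂ φ (weylOp χ c ψ) = 0 := by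
  by_cases hQ : stabilizerCode χ D μ = ⊥
  · rw [(Submodule.eq_bot_iff _).mp hQ φ hφ, inner_zero_left]
  obtain ⟨v, hv, hχv⟩ := exists_addChar_sympInner_ne_one hχ hc
  have hnorm : (starRingEnd ℂ) (μ ⟨v, hv⟩) * μ ⟨v, hv⟩ = 1 := by
    rw [Complex.conj_mul', norm_eigenvalue hQ, Complex.ofReal_one, one_pow]
  have hinner : inner ℂ φ (weylOp χ c ψ) = χ (sympInner c v) * inner ℂ φ (weylOp χ c ψ) :=
    calc inner ℂ φ (weylOp χ c ψ)
        = inner ℂ (weylOp χ v φ) (weylOp χ v (weylOp χ c ψ)) := (inner_weylOp_weylOp χ v _ _).symm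
      _ = (starRingEnd ℂ (μ ⟨v, hv⟩) * μ ⟨v, hv⟩) *
            (χ (sympInner c v) * inner ℂ φ (weylOp χ c ψ)) := by
        rw [weylOp_weylOp_comm, mem_iff.mp hφ ⟨v, hv⟩, mem_iff.mp hψ ⟨v, hv⟩, map_smul,
          inner_smul_left, inner_smul_right, inner_smul_right]
        ring
      _ = χ (sympInner c v) * inner ℂ φ (weylOp χ c ψ) := by rw [hnorm, one_mul]
  by_contra hne
  exact hχv ((mul_eq_right₀ hne).mp hinner.symm)

end stabilizerCode

end SympDual

section Detection

variable {F : Type*} [Field F] [Fintype F] [DecidableEq F] {n : ℕ}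

/-- The errors detected by `Q`, as a linear subspace of the operators. -/
def detectedErrors (Q : Submodule ℂ (QuditSpace F n)) :
    Submodule ℂ (Matrix (Fin n → F) (Fin n → F) ℂ) where
  carrier := {E | Detects Q E}
  zero_mem' := ⟨0, fun φ _ ψ _ => by simp⟩
  add_mem' := by
    rintro A B ⟨a, hA⟩ ⟨b, hB⟩
    refine ⟨a + b, fun φ hφ ψ hψ => ?_⟩
    rw [map_add, LinearMap.add_apply, inner_add_right, hA φ hφ ψ hψ, hB φ hφ ψ hψ, add_mul]
  smul_mem' := by
    rintro z A ⟨a, hA⟩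
    refine ⟨z * a, fun φ hφ ψ hψ => ?_⟩
    rw [map_smul, LinearMap.smul_apply, inner_smul_right, hA φ hφ ψ hψ, mul_assoc]

/-- The errors detected purely by `Q`, as a linear subspace of the operators. -/
def purelyDetectedErrors (Q : Submodule ℂ (QuditSpace F n)) :
    Submodule ℂ (Matrix (Fin n → F) (Fin n → F) ℂ) where
  carrier := {E | PurelyDetects Q E}
  zero_mem' φ _ ψ _ := by simp
  add_mem' {A B} hA hB φ hφ ψ hψ := by
    rw [map_add, LinearMap.add_apply, inner_add_right, hA φ hφ ψ hψ, hB φ hφ ψ hψ,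
      Matrix.trace_add, add_div, add_mul]
  smul_mem' z A hA φ hφ ψ hψ := by
    rw [map_smul, LinearMap.smul_apply, inner_smul_right, hA φ hφ ψ hψ, Matrix.trace_smul,
      smul_eq_mul, mul_div_assoc, mul_assoc]

variable {χ : AddChar F ℂ} {D : Submodule F ((Fin n → F) × (Fin n → F))} {μ : D → ℂ}

namespace stabilizerCode

lemma mem_of_detects_weylMatrix (hχ : χ.IsPrimitive) (hQ : stabilizerCode χ D μ ≠ ⊥)
    {c : (Fin n → F) × (Fin n → F)} (hc : c ∈ sympDual D)
    (hdet : Detects (stabilizerCode χ D μ) (weylMatrix χ c)) : c ∈ D := by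
  obtain ⟨a, ha⟩ := hdet
  have hscalar {ψ : QuditSpace F n} (hψ : ψ ∈ stabilizerCode χ D μ) : weylOp χ c ψ = a • ψ := by
    have hmem : weylOp χ c ψ - a • ψ ∈ stabilizerCode χ D μ :=
      Submodule.sub_mem _ (weylOp_mem hc hψ) (Submodule.smul_mem _ a hψ)
    rw [← sub_eq_zero, ← inner_self_eq_zero (𝕜 := ℂ), inner_sub_right, inner_smul_right,
      sub_eq_zero]
    exact ha _ hmem ψ hψ
  by_contra hcD
  rw [← sympDual_sympDual D] at hcD
  obtain ⟨v, hv, hχv⟩ := exists_addChar_sympInner_ne_one hχ hcD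
  obtain ⟨ψ, hψ, hψ0⟩ := Submodule.exists_mem_ne_zero_of_ne_bot hQ
  have hcomm := weylOp_weylOp_comm χ v c ψ
  rw [hscalar hψ, map_smul, ← hscalar (weylOp_mem hv hψ)] at hcomm
  have hne : weylOp χ c (weylOp χ v ψ) ≠ 0 := weylOp_ne_zero χ c (weylOp_ne_zero χ v hψ0)
  exact hχv (smul_left_injective ℂ hne (by simpa using hcomm.symm))

lemma detects_weylMatrix_iff (hχ : χ.IsPrimitive) (hQ : stabilizerCode χ D μ ≠ ⊥)
    (c : (Fin n → F) × (Fin n → F)) :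
    Detects (stabilizerCode χ D μ) (weylMatrix χ c) ↔ (c ∈ sympDual D → c ∈ D) := by
  refine ⟨fun hdet hc => mem_of_detects_weylMatrix hχ hQ hc hdet, fun h => ?_⟩
  by_cases hc : c ∈ sympDual D
  · refine ⟨μ ⟨c, h hc⟩, fun φ _ ψ hψ => ?_⟩
    rw [← weylOp, mem_iff.mp hψ ⟨c, h hc⟩, inner_smul_right]
  · refine ⟨0, fun φ hφ ψ hψ => ?_⟩
    rw [← weylOp, inner_weylOp_eq_zero hχ hc hφ hψ, zero_mul]

lemma purelyDetects_weylMatrix_iff (hχ : χ.IsPrimitive) (hQ : stabilizerCode χ D μ ≠ ⊥)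
    (c : (Fin n → F) × (Fin n → F)) :
    PurelyDetects (stabilizerCode χ D μ) (weylMatrix χ c) ↔ (c ∈ sympDual D → c = 0) := by
  constructor
  · intro hpure hc
    have hcD : c ∈ D := mem_of_detects_weylMatrix hχ hQ hc ⟨_, hpure⟩
    obtain ⟨ψ, hψ, hψ0⟩ := Submodule.exists_mem_ne_zero_of_ne_bot hQ
    by_contra hc0
    have hinner := hpure ψ hψ ψ hψ
    rw [← weylOp, mem_iff.mp hψ ⟨c, hcD⟩, inner_smul_right, trace_weylMatrix hχ, if_neg hc0,
      zero_div, zero_mul] at hinner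
    exact mul_ne_zero (eigenvalue_ne_zero hQ _) (inner_self_ne_zero.mpr hψ0) hinner
  · intro h φ hφ ψ hψ
    rw [← weylOp]
    by_cases hc : c ∈ sympDual D
    · have hcard : (Fintype.card F : ℂ) ≠ 0 := Nat.cast_ne_zero.mpr Fintype.card_ne_zero
      simp [h hc, weylOp_zero, weylMatrix_zero, hcard]
    · have hc0 : c ≠ 0 := fun h0 => hc (h0 ▸ zero_mem _)
      rw [inner_weylOp_eq_zero hχ hc hφ hψ, trace_weylMatrix hχ, if_neg hc0, zero_div, zero_mul]

lemma isQuantumCode (hχ : χ.IsPrimitive) (hQ : stabilizerCode χ D μ ≠ ⊥) {K d : ℕ} (hK0 : K ≠ 0)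
    (hK : Module.finrank F D + K = n)
    (hd : IsLeast (sympWeight '' {c | c ∈ sympDual D ∧ c ∉ D}) d) :
    IsQuantumCode (stabilizerCode χ D μ) K d := by
  have hset : {c | c ∈ sympDual D ∧ c ∉ D} =
      {c | weylMatrix χ c ∉ detectedErrors (stabilizerCode χ D μ)} :=
    Set.ext fun c => (Classical.not_imp.symm.trans (detects_weylMatrix_iff hχ hQ c).not.symm)
  rw [hset] at hd
  refine ⟨finrank_eq hχ hQ hK, fun S hS A => ?_, ?_⟩
  · rw [if_neg hK0]
    exact localOp_mem_of_card_lt hχ hd.2 hS A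
  · simp only [if_neg hK0]
    exact exists_localOp_notMem hd.1

lemma isQuantumCode_zero (hχ : χ.IsPrimitive) (hQ : stabilizerCode χ D μ ≠ ⊥) {d : ℕ}
    (hD : Module.finrank F D = n)
    (hd : IsLeast (sympWeight '' {c | c ∈ sympDual D ∧ c ≠ 0}) d) :
    IsQuantumCode (stabilizerCode χ D μ) 0 d := by
  have hset : {c | c ∈ sympDual D ∧ c ≠ 0} =
      {c | weylMatrix χ c ∉ purelyDetectedErrors (stabilizerCode χ D μ)} :=
    Set.ext fun c => (Classical.not_imp.symm.trans (purelyDetects_weylMatrix_iff hχ hQ c).not.symm)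
  rw [hset] at hd
  refine ⟨finrank_eq hχ hQ hD, fun S hS A => ?_, ?_⟩
  · rw [if_pos rfl]
    exact localOp_mem_of_card_lt hχ hd.2 hS A
  · simp only [if_true]
    exact exists_localOp_notMem hd.1

end stabilizerCode

end Detection

theorem mainTheorem10 {F : Type*} [Field F] [Fintype F] [DecidableEq F] (n k : ℕ) (hn : 0 < n)
    (C : Submodule F ((Fin n → F) × (Fin n → F))) (hk : Module.finrank F C = k)
    (hC : sympDual C ≤ C) :
    n ≤ k ∧
    (n < k → ∃ d : ℕ,
      IsLeast (sympWeight '' {c | c ∈ C ∧ c ∉ sympDual C}) d ∧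
        ∃ Q : Submodule ℂ (QuditSpace F n), IsQuantumCode Q (k - n) d) ∧
    (k = n → ∃ d : ℕ,
      IsLeast (sympWeight '' {c | c ∈ C ∧ c ≠ 0}) d ∧
        ∃ Q : Submodule ℂ (QuditSpace F n), IsQuantumCode Q 0 d) := by
  obtain ⟨D, rfl⟩ : ∃ D, C = sympDual D := ⟨sympDual C, (sympDual_sympDual C).symm⟩
  rw [sympDual_sympDual] at hC ⊢
  have hdim := finrank_add_finrank_sympDual D
  have hle := Submodule.finrank_mono hC
  have hχ := AddChar.FiniteField.primitiveChar_to_Complex_isPrimitive F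
  obtain ⟨μ, hQ⟩ := stabilizerCode.exists_ne_bot (AddChar.FiniteField.primitiveChar_to_Complex F) hC
  refine ⟨by omega, fun hnk => ?_, fun hkn => ?_⟩
  · have hne : {c | c ∈ sympDual D ∧ c ∉ D}.Nonempty :=
      Set.not_subset.mp fun hsub => by
        have := Submodule.finrank_mono (show sympDual D ≤ D from hsub)
        omega
    have hd := isLeast_csInf (hne.image sympWeight)
    exact ⟨_, hd, _, stabilizerCode.isQuantumCode hχ hQ (by omega) (by omega) hd⟩
  · have hne : {c | c ∈ sympDual D ∧ c ≠ 0}.Nonempty :=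
      (Submodule.ne_bot_iff _).mp fun hbot => by
        rw [hbot, finrank_bot] at hk
        omega
    have hd := isLeast_csInf (hne.image sympWeight)
    exact ⟨_, hd, _, stabilizerCode.isQuantumCode_zero hχ hQ (by omega) hd⟩
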